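/- Let $\Lambda=[\lambda_1,\dots,\lambda_N]$ be a non-ordered vector of real numbers (repetitions allowed) that is symmetric, i.e. $\Lambda=-\Lambda$ as non-ordered vectors. Put $L_\Lambda(z)=\prod_{j=1}^N(z-\lambda_j)$ and $r(\lambda)=\prod_{j=1}^N(e^{\lambda_j}-\lambda)$. For $\lambda\in\mathbb C\setminus\{e^{\lambda_1},\dots,e^{\lambda_N}\}$ let $$A_{N-1}(x;\lambda)=\frac1{2\pi i}\int_\Gamma\frac1{L_\Lambda(z)}\,\frac{e^{xz}}{e^z-\lambda}\,dz ,$$ where $\Gamma$ is any piecewise $C^1$ closed contour that surrounds all the points $\lambda_j$ (it does not meet them and has winding number $1$ about each of them) and excludes all zeros of $z\mapsto e^z-\lambda$ (it does not meet them and has winding number $0$ about each of them). Then there is exactly one polynomial $\Pi_{N-1}\in\mathbb C[\lambda]$, the Euler–Frobenius polynomial of $\Lambda$, such that $\Pi_{N-1}(\lambda)=r(\lambda)A_{N-1}(0;\lambda)$ for all such $\lambda$ and $\Gamma$. It satisfies $$|\Pi_{N-1}(-1)|\le|\Pi_{N-1}(e^{i\xi})|\le|\Pi_{N-1}(1)|\qquad\text{for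 all }\xi\in\mathbb R .$$ -/

import Mathlib

open scoped Polynomial

noncomputable section

namespace ExpSpline

/-- The contour integral `∮_Γ f(z) dz` of `f : ℂ → ℂ` along a closed path `Γ` in `ℂ`. -/
def contourIntegral (f : ℂ → ℂ) {a : ℂ} (Γ : Path a a) : ℂ :=
  curveIntegral (fun z : ℂ => f z • ContinuousLinearMap.id ℂ ℂ) Γ

/-- `Γ` is piecewise continuously differentiable: for some partition
`0 = t 0 ≤ t 1 ≤ ⋯ ≤ t n = 1` it is `C¹` on every closed interval `[t i, t (i + 1)]`. -/
def IsPiecewiseC1 {a : ℂ} (Γ : Path a a) : Prop :=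
  ∃ (n : ℕ) (t : ℕ → ℝ), Monotone t ∧ t 0 = 0 ∧ t n = 1 ∧
    ∀ i < n, ContDiffOn ℝ 1 Γ.extend (Set.Icc (t i) (t (i + 1)))

/-- The winding number of the closed path `Γ` about the point `w`. -/
def windingNumber {a : ℂ} (Γ : Path a a) (w : ℂ) : ℂ :=
  (2 * Real.pi * Complex.I)⁻¹ * contourIntegral (fun z => (z - w)⁻¹) Γ

/-- The characteristic polynomial `L_Λ(z) = ∏_j (z - λ_j)` of the non-ordered vector `Λ`
(a multiset: entries may repeat, the order is irrelevant). -/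
def charPoly (Λ : Multiset ℝ) (z : ℂ) : ℂ :=
  (Λ.map fun μ : ℝ => z - (μ : ℂ)).prod

/-- `r(lam) = ∏_j (e^{λ_j} - lam)`. -/
def r (Λ : Multiset ℝ) (lam : ℂ) : ℂ :=
  (Λ.map fun μ : ℝ => Complex.exp (μ : ℂ) - lam).prod

/-- `Γ` is a piecewise `C¹` closed contour that surrounds (once, counterclockwise) every `λ_j`
of `Λ` and excludes (neither meets nor winds around) every zero of `z ↦ e^z - lam`. -/
structure IsAdmissible (Λ : Multiset ℝ) (lam : ℂ) {a : ℂ} (Γ : Path a a) : Prop where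
  piecewiseC1 : IsPiecewiseC1 Γ
  notMem_of_mem : ∀ μ ∈ Λ, (μ : ℂ) ∉ Set.range Γ
  winding_eq_one : ∀ μ ∈ Λ, windingNumber Γ (μ : ℂ) = 1
  notMem_of_exp_eq : ∀ w : ℂ, Complex.exp w = lam → w ∉ Set.range Γ
  winding_eq_zero : ∀ w : ℂ, Complex.exp w = lam → windingNumber Γ w = 0

/-- The contour integral `A_{N-1}(x; lam) = (2πi)⁻¹ ∮_Γ e^{xz} / (L_Λ(z) (e^z - lam)) dz`,
taken along the contour `Γ`. -/
def A (Λ : Multiset ℝ) (x : ℝ) (lam : ℂ) {a : ℂ} (Γ : Path a a) : ℂ :=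
  (2 * Real.pi * Complex.I)⁻¹ *
    contourIntegral
      (fun z => 1 / charPoly Λ z * (Complex.exp (x * z) / (Complex.exp z - lam))) Γ

/-- `P` is the polynomial `lam ↦ Π_{N-1}(x; lam)`, i.e. `P(lam) = r(lam) A_{N-1}(x; lam)`
for every `lam` for which `A_{N-1}(x; lam)` is defined, along every admissible contour.
(There is no admissible contour exactly when `lam = e^{λ_j}` for some `j`; there the value of `P`
is determined by its being a polynomial.) -/
def IsPi (Λ : Multiset ℝ) (x : ℝ) (P : ℂ[X]) : Prop :=
  ∀ (lam : ℂ) (a : ℂ) (Γ : Path a a), IsAdmissible Λ lam Γ → P.eval lam = r Λ lam * A Λ x lam Γ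

/-- `P` is the Euler-Frobenius polynomial `Π_{N-1}(lam) = Π_{N-1}(0; lam)` of `Λ`, where
`N = Λ.card`. -/
def IsEulerFrobenius (Λ : Multiset ℝ) (P : ℂ[X]) : Prop :=
  IsPi Λ 0 P

end ExpSpline

end

/-! The inequality reduces to one fact: every zero of $\Pi_{N-1}$ is a real number $-b$ with $b\ge
0$. For $|z|=1$ the triangle inequalities give $|b-1|\le|z+b|\le 1+b$, and multiplying over the
zeros compares $|\Pi_{N-1}|$ at $-1$, $z$ and $1$.

To locate the zeros, keep the variable $x$. Adjoining an entry $\mu$ to $\Lambda$ gives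
$(d/dx-\mu)A_{\mu\cup\Lambda}=A_\Lambda$ (`IsAdmissible.hasDerivAt_A`). The boundary relation is
$A(1)=\lambda A(0)$ if $N\ge2$ and $A(1)-\lambda A(0)=1$ if $N=1$ (`IsAdmissible.A_one_sub`).
Solving these problems successively expresses $rA$, up to sign, by the contour-free recursion
`signedPi` (`IsAdmissible.r_mul_A_eq`), visibly a polynomial in $\lambda$ with real coefficients.

Up to positive factors, one step of the recursion replaces a function $w$, extended by $w(x+1)=\rho
w(x)$, by $W(x)=\int_x^{x+1}w$. If $\operatorname{Im}\rho>0$ and $w$ turns counterclockwise by less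
than a half-turn per period, then so does $W$, and $W$ has no zero because the values averaged lie
in a sector narrower than a half-plane (`IsTurning.integral`). Hence there are no zeros with
$\operatorname{Im}\lambda>0$, nor, by conjugation, with $\operatorname{Im}\lambda<0$. For
$\lambda>0$ everything in the recursion is positive.

Uniqueness holds because large circles are admissible for infinitely many $\lambda$. -/

namespace ExpSpline

open Set MeasureTheory

/-! ### Contour integrals along piecewise `C¹` closed paths -/

theorem contourIntegral_eq_intervalIntegral (f : ℂ → ℂ) {a : ℂ} (Γ : Path a a) :
    contourIntegral f Γ =
      ∫ t in (0 : ℝ)..1, f (Γ.extend t) * derivWithin Γ.extend (Icc 0 1) t := by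
  rw [contourIntegral, curveIntegral_def]
  refine intervalIntegral.integral_congr fun t _ => ?_
  simp [curveIntegralFun_def]

theorem extend_mem_range {a : ℂ} (Γ : Path a a) (t : ℝ) : Γ.extend t ∈ range Γ := by
  rw [← Γ.extend_range]; exact mem_range_self t

theorem IsPiecewiseC1.intervalIntegrable {a : ℂ} {Γ : Path a a} (h : IsPiecewiseC1 Γ) :
    IntervalIntegrable (derivWithin Γ.extend (Icc 0 1)) volume 0 1 := by
  obtain ⟨n, t, ht, h0, h1, hC⟩ := h
  rw [← h0, ← h1]
  refine IntervalIntegrable.trans_iterate fun i hi => ?_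
  rcases (ht i.le_succ).eq_or_lt with heq | hlt
  · rw [heq]
  have hcont : ContinuousOn (derivWithin Γ.extend (Icc (t i) (t (i + 1))))
      (Icc (t i) (t (i + 1))) :=
    (hC i hi).continuousOn_derivWithin (uniqueDiffOn_Icc hlt) le_rfl
  have hint := hcont.intervalIntegrable_of_Icc (μ := volume) hlt.le
  -- The one-sided derivatives relative to the piece and to $[0,1]$ can differ only at breakpoints,
  -- a null set.
  refine hint.congr_ae ?_
  rw [uIoc_of_le hlt.le, ← restrict_Ioo_eq_restrict_Ioc]
  refine (ae_restrict_mem measurableSet_Ioo).mono fun s hs => ?_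
  have hmem : Icc (t i) (t (i + 1)) ∈ nhds s := Icc_mem_nhds hs.1 hs.2
  have hsub : Icc (t i) (t (i + 1)) ⊆ Icc (t 0) (t n) :=
    Icc_subset_Icc (ht (Nat.zero_le i)) (ht hi)
  rw [h0, h1] at *
  rw [derivWithin_of_mem_nhds hmem, derivWithin_of_mem_nhds (Filter.mem_of_superset hmem hsub)]

theorem IsPiecewiseC1.hasDerivAt {a : ℂ} {Γ : Path a a} (h : IsPiecewiseC1 Γ) :
    ∃ s : Set ℝ, s.Countable ∧ ∀ x ∈ Ioo (0 : ℝ) 1 \ s,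
      HasDerivAt Γ.extend (derivWithin Γ.extend (Icc 0 1) x) x := by
  obtain ⟨n, t, ht, h0, h1, hC⟩ := h
  refine ⟨range t, countable_range t, fun x hx => ?_⟩
  have hex : ∃ i, x ≤ t i := ⟨n, h1 ▸ hx.1.2.le⟩
  classical
  obtain ⟨i, hi⟩ : ∃ i, Nat.find hex = i + 1 := by
    refine Nat.exists_eq_succ_of_ne_zero fun h => ?_
    have := Nat.find_spec hex
    rw [h, h0] at this
    exact this.not_gt hx.1.1
  have hle : x ≤ t (i + 1) := hi ▸ Nat.find_spec hex
  have hgt : t i < x := not_le.1 (Nat.find_min hex (by omega))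
  have hlt : x < t (i + 1) := hle.lt_of_ne fun h => hx.2 ⟨_, h.symm⟩
  have hin : i < n := by
    have : Nat.find hex ≤ n := Nat.find_min' hex (h1 ▸ hx.1.2.le)
    omega
  have hd : DifferentiableAt ℝ Γ.extend x :=
    ((hC i hin).differentiableOn one_ne_zero).differentiableAt (Icc_mem_nhds hgt hlt)
  rw [derivWithin_of_mem_nhds (Icc_mem_nhds hx.1.1 hx.1.2)]
  exact hd.hasDerivAt

theorem IsPiecewiseC1.intervalIntegrable_mul {a : ℂ} {Γ : Path a a} (h : IsPiecewiseC1 Γ)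
    {f : ℂ → ℂ} (hf : ContinuousOn f (range Γ)) :
    IntervalIntegrable (fun t => f (Γ.extend t) * derivWithin Γ.extend (Icc 0 1) t)
      volume 0 1 :=
  h.intervalIntegrable.continuousOn_mul
    (hf.comp Γ.continuous_extend.continuousOn fun t _ => extend_mem_range Γ t)

theorem contourIntegral_congr {a : ℂ} {Γ : Path a a} {f g : ℂ → ℂ} (h : EqOn f g (range Γ)) :
    contourIntegral f Γ = contourIntegral g Γ := by
  simp only [contourIntegral_eq_intervalIntegral]
  exact intervalIntegral.integral_congr fun t _ => by
    simp only [h (extend_mem_range Γ t)]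

theorem contourIntegral_const_mul {a : ℂ} (Γ : Path a a) (c : ℂ) (f : ℂ → ℂ) :
    contourIntegral (fun z => c * f z) Γ = c * contourIntegral f Γ := by
  simp only [contourIntegral_eq_intervalIntegral, mul_assoc]
  exact intervalIntegral.integral_const_mul _ _

theorem IsPiecewiseC1.contourIntegral_add {a : ℂ} {Γ : Path a a} (h : IsPiecewiseC1 Γ)
    {f g : ℂ → ℂ} (hf : ContinuousOn f (range Γ)) (hg : ContinuousOn g (range Γ)) :
    contourIntegral (fun z => f z + g z) Γ = contourIntegral f Γ + contourIntegral g Γ := by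
  simp only [contourIntegral_eq_intervalIntegral, add_mul]
  exact intervalIntegral.integral_add (h.intervalIntegrable_mul hf) (h.intervalIntegrable_mul hg)

theorem IsPiecewiseC1.contourIntegral_sub {a : ℂ} {Γ : Path a a} (h : IsPiecewiseC1 Γ)
    {f g : ℂ → ℂ} (hf : ContinuousOn f (range Γ)) (hg : ContinuousOn g (range Γ)) :
    contourIntegral (fun z => f z - g z) Γ = contourIntegral f Γ - contourIntegral g Γ := by
  simp only [contourIntegral_eq_intervalIntegral, sub_mul]
  exact intervalIntegral.integral_sub (h.intervalIntegrable_mul hf) (h.intervalIntegrable_mul hg)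

theorem IsPiecewiseC1.contourIntegral_eq_zero_of_hasDerivAt {a : ℂ} {Γ : Path a a}
    (h : IsPiecewiseC1 Γ) {f F : ℂ → ℂ} (hf : ContinuousOn f (range Γ))
    (hF : ∀ z ∈ range Γ, HasDerivAt F (f z) z) : contourIntegral f Γ = 0 := by
  obtain ⟨s, hs, hd⟩ := h.hasDerivAt
  rw [contourIntegral_eq_intervalIntegral,
    integral_eq_of_hasDerivAt_off_countable_of_le (fun t => F (Γ.extend t)) _ zero_le_one hs
      ?_ ?_ (h.intervalIntegrable_mul hf)]
  · simp
  · intro t _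
    exact ((hF _ (extend_mem_range Γ t)).continuousAt.comp
      Γ.continuous_extend.continuousAt).continuousWithinAt
  · intro t ht
    exact (hF _ (extend_mem_range Γ t)).comp t (hd t ht)

theorem continuousOn_inv_sub {a w : ℂ} {Γ : Path a a} (hw : w ∉ range Γ) :
    ContinuousOn (fun z : ℂ => (z - w)⁻¹) (range Γ) :=
  (continuousOn_id.sub continuousOn_const).inv₀ fun _ hz h => hw ((sub_eq_zero.1 h : _ = w) ▸ hz)

/-! ### Cauchy's theorem for simple poles with winding number zero -/

theorem contourIntegral_inv_sub_eq {a : ℂ} (Γ : Path a a) (w : ℂ) :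
    contourIntegral (fun z => (z - w)⁻¹) Γ = 2 * Real.pi * Complex.I * windingNumber Γ w := by
  rw [windingNumber, mul_inv_cancel_left₀ Complex.two_pi_I_ne_zero]

theorem prod_sub_ne_zero {S : Finset ℂ} {z : ℂ} (hz : z ∉ S) : ∏ w ∈ S, (z - w) ≠ 0 :=
  Finset.prod_ne_zero_iff.2 fun _ hw h => hz (sub_eq_zero.1 h ▸ hw)

theorem exists_eq_prod_sub_mul (S : Finset ℂ) {f : ℂ → ℂ} (hf : Differentiable ℂ f)
    (hS : ∀ w ∈ S, f w = 0) :
    ∃ k : ℂ → ℂ, Differentiable ℂ k ∧ ∀ z, f z = (∏ w ∈ S, (z - w)) * k z := by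
  classical
  induction S using Finset.induction_on with
  | empty => exact ⟨f, hf, by simp⟩
  | insert b S hb ih =>
    obtain ⟨k, hk, hfk⟩ := ih fun w hw => hS w (Finset.mem_insert_of_mem hw)
    have hkb : k b = 0 := by
      have := hfk b
      rw [hS b (Finset.mem_insert_self b S)] at this
      exact (mul_eq_zero.1 this.symm).resolve_left (prod_sub_ne_zero hb)
    refine ⟨dslope k b, ?_, fun z => ?_⟩
    · rw [← differentiableOn_univ, Complex.differentiableOn_dslope Filter.univ_mem]
      exact hk.differentiableOn
    · have := sub_smul_dslope k b z
      rw [hkb, sub_zero, smul_eq_mul] at this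
      rw [hfk, Finset.prod_insert hb, ← this]
      ring

/-- The poles are split off one at a time. Each contributes a multiple of its winding number, which
is zero; the remaining function is holomorphic on a ball and has a primitive there. -/
theorem IsPiecewiseC1.contourIntegral_div_prod_sub_eq_zero {a : ℂ} {Γ : Path a a}
    (h : IsPiecewiseC1 Γ) {R : ℝ} (hR : range Γ ⊆ Metric.ball 0 R) (S : Finset ℂ)
    (hSR : ∀ w ∈ S, w ∈ Metric.ball (0 : ℂ) R) (hS : ∀ w ∈ S, w ∉ range Γ)
    (hw : ∀ w ∈ S, windingNumber Γ w = 0) {m : ℂ → ℂ}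
    (hm : DifferentiableOn ℂ m (Metric.ball 0 R)) :
    contourIntegral (fun z => m z / ∏ w ∈ S, (z - w)) Γ = 0 := by
  classical
  induction S using Finset.induction_on generalizing m with
  | empty =>
    obtain ⟨F, hF⟩ := hm.isExactOn_ball
    simp only [Finset.prod_empty, div_one]
    exact h.contourIntegral_eq_zero_of_hasDerivAt (hm.continuousOn.mono hR)
      fun z hz => hF z (hR hz)
  | insert b S hb ih =>
    simp only [Finset.forall_mem_insert] at hSR hS hw
    set q : ℂ → ℂ := fun z => ∏ w ∈ S, (z - w) with hq
    have hqd : Differentiable ℂ q := by fun_prop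
    have hqb : q b ≠ 0 := prod_sub_ne_zero hb
    -- Subtracting the principal part at `b` makes the numerator vanish there, so division by `z -
    -- b` leaves a quotient of the same form with one pole fewer.
    set f : ℂ → ℂ := fun z => m z - m b / q b * q z with hf
    have hfb : f b = 0 := by simp only [hf]; field_simp; ring
    have hfd : DifferentiableOn ℂ f (Metric.ball 0 R) :=
      hm.sub ((hqd.const_mul _).differentiableOn)
    have hn : DifferentiableOn ℂ (dslope f b) (Metric.ball 0 R) :=
      (Complex.differentiableOn_dslope (Metric.isOpen_ball.mem_nhds hSR.1)).2 hfd
    have hq0 : ∀ z ∈ range Γ, q z ≠ 0 := fun z hz =>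
      prod_sub_ne_zero fun hzS => hS.2 z hzS hz
    have hcong : EqOn (fun z => m z / ∏ w ∈ insert b S, (z - w))
        (fun z => m b / q b * (z - b)⁻¹ + dslope f b z / q z) (range Γ) := by
      intro z hz
      have hzb : z - b ≠ 0 := fun h => hS.1 (sub_eq_zero.1 h ▸ hz)
      have hqz := hq0 z hz
      have := sub_smul_dslope f b z
      rw [hfb, sub_zero, smul_eq_mul] at this
      have hd : dslope f b z = f z / (z - b) := by rw [← this]; field_simp
      simp only [Finset.prod_insert hb, hd]
      change m z / ((z - b) * q z) = _
      simp only [hf]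
      field_simp
      ring
    rw [contourIntegral_congr hcong, h.contourIntegral_add
      (f := fun z => m b / q b * (z - b)⁻¹) (g := fun z => dslope f b z / q z)
      (continuousOn_const.mul (continuousOn_inv_sub hS.1))
      ((hn.continuousOn.mono hR).div hqd.continuous.continuousOn hq0),
      contourIntegral_const_mul, contourIntegral_inv_sub_eq, hw.1, ih hSR.2 hS.2 hw.2 hn]
    simp

theorem finite_exp_eq (lam : ℂ) (R : ℝ) :
    {w : ℂ | Complex.exp w = lam ∧ w ∈ Metric.ball (0 : ℂ) R}.Finite := by
  rcases eq_or_ne lam 0 with rfl | h0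
  · simp [Complex.exp_ne_zero]
  set M : ℤ := ⌈R + ‖Complex.log lam‖⌉
  refine ((finite_Icc (-M) M).image
    fun n : ℤ => Complex.log lam + n * (2 * Real.pi * Complex.I)).subset ?_
  rintro w ⟨hw, hwR⟩
  rw [← Complex.exp_log h0, Complex.exp_eq_exp_iff_exists_int] at hw
  obtain ⟨n, rfl⟩ := hw
  refine ⟨n, ?_, rfl⟩
  rw [mem_ball_zero_iff] at hwR
  have h1 : ‖(n : ℂ) * (2 * Real.pi * Complex.I)‖ = |(n : ℝ)| * (2 * Real.pi) := by
    simp [abs_of_pos Real.pi_pos]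
  have h2 : ‖(n : ℂ) * (2 * Real.pi * Complex.I)‖ ≤ R + ‖Complex.log lam‖ := by
    have := norm_sub_le (Complex.log lam + n * (2 * Real.pi * Complex.I)) (Complex.log lam)
    rw [add_sub_cancel_left] at this
    linarith
  have h3 : |(n : ℝ)| ≤ R + ‖Complex.log lam‖ := by
    have := Real.two_le_pi
    nlinarith [abs_nonneg (n : ℝ)]
  have h4 : |(n : ℝ)| ≤ M := h3.trans (Int.le_ceil _)
  exact abs_le.1 (by exact_mod_cast h4)

/-- Only finitely many zeros of $e^z-\lambda$ lie in a ball containing the contour, and all are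
simple. This yields $A=0$ for the empty vector, the start of the recursion. -/
theorem IsPiecewiseC1.contourIntegral_div_exp_sub_eq_zero {a : ℂ} {Γ : Path a a}
    (h : IsPiecewiseC1 Γ) {lam : ℂ} (hmem : ∀ w : ℂ, Complex.exp w = lam → w ∉ range Γ)
    (hwind : ∀ w : ℂ, Complex.exp w = lam → windingNumber Γ w = 0) {g : ℂ → ℂ}
    (hg : Differentiable ℂ g) :
    contourIntegral (fun z => g z / (Complex.exp z - lam)) Γ = 0 := by
  obtain ⟨R, hR⟩ := (isCompact_range Γ.continuous).isBounded.subset_ball 0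
  set S := (finite_exp_eq lam R).toFinset with hSdef
  have hS : ∀ w, w ∈ S ↔ Complex.exp w = lam ∧ w ∈ Metric.ball (0 : ℂ) R := by simp [hSdef]
  have hE : Differentiable ℂ fun z => Complex.exp z - lam := by fun_prop
  obtain ⟨k, hk, hEk⟩ := exists_eq_prod_sub_mul S hE fun w hw => sub_eq_zero.2 ((hS w).1 hw).1
  have hk0 : ∀ z ∈ Metric.ball (0 : ℂ) R, k z ≠ 0 := by
    intro z hz hkz
    have hez : Complex.exp z = lam := by
      have := hEk z
      rwa [hkz, mul_zero, sub_eq_zero] at this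
    have hzS : z ∈ S := (hS z).2 ⟨hez, hz⟩
    -- A zero of `k` at `z` would make `z` a double zero, contradicting that the derivative $e^z$
    -- does not vanish.
    have hd : HasDerivAt (fun z => Complex.exp z - lam) (Complex.exp z) z :=
      (Complex.hasDerivAt_exp z).sub_const lam
    have hp : DifferentiableAt ℂ (fun z => ∏ w ∈ S, (z - w)) z := by fun_prop
    have hd' := hp.hasDerivAt.mul (hk z).hasDerivAt
    have h0 : ∏ w ∈ S, (z - w) = 0 := Finset.prod_eq_zero hzS (sub_self z)
    rw [hkz, h0, mul_zero, zero_mul, add_zero] at hd'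
    refine Complex.exp_ne_zero z (hd.unique (hd'.congr_of_eventuallyEq ?_))
    exact Filter.Eventually.of_forall hEk
  rw [← h.contourIntegral_div_prod_sub_eq_zero hR S (fun w hw => ((hS w).1 hw).2)
    (fun w hw => hmem w ((hS w).1 hw).1) (fun w hw => hwind w ((hS w).1 hw).1)
    (hg.differentiableOn.div hk.differentiableOn hk0)]
  refine contourIntegral_congr fun z _ => ?_
  simp only [Pi.div_apply, hEk z, div_div, mul_comm]

/-! ### The integral of the reciprocal of a polynomial around all its zeros -/

theorem continuous_charPoly (Λ : Multiset ℝ) : Continuous (charPoly Λ) := by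
  induction Λ using Multiset.induction_on with
  | empty =>
    have : charPoly 0 = fun _ => 1 := by ext z; simp [charPoly]
    rw [this]
    exact continuous_const
  | cons μ Λ ih =>
    have : charPoly (μ ::ₘ Λ) = fun z => (z - (μ : ℂ)) * charPoly Λ z := by
      ext z; simp [charPoly]
    rw [this]
    fun_prop

theorem charPoly_cons (μ : ℝ) (Λ : Multiset ℝ) (z : ℂ) :
    charPoly (μ ::ₘ Λ) z = (z - μ) * charPoly Λ z := by
  simp [charPoly]

theorem charPoly_zero (z : ℂ) : charPoly 0 z = 1 := by
  simp [charPoly]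

theorem charPoly_ne_zero {Λ : Multiset ℝ} {z : ℂ} (h : ∀ μ ∈ Λ, z ≠ (μ : ℂ)) :
    charPoly Λ z ≠ 0 := by
  rw [charPoly, Ne, Multiset.prod_eq_zero_iff, Multiset.mem_map]
  rintro ⟨μ, hμ, h0⟩
  exact h μ hμ (sub_eq_zero.1 h0)

theorem charPoly_ne_zero_of_mem_range {Λ : Multiset ℝ} {a : ℂ} {Γ : Path a a}
    (hmem : ∀ μ ∈ Λ, (μ : ℂ) ∉ range Γ) {z : ℂ} (hz : z ∈ range Γ) : charPoly Λ z ≠ 0 :=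
  charPoly_ne_zero fun μ hμ h => hmem μ hμ (h ▸ hz)

theorem continuousOn_inv_charPoly {Λ : Multiset ℝ} {a : ℂ} {Γ : Path a a}
    (hmem : ∀ μ ∈ Λ, (μ : ℂ) ∉ range Γ) :
    ContinuousOn (fun z => (charPoly Λ z)⁻¹) (range Γ) :=
  (continuous_charPoly Λ).continuousOn.inv₀ fun _ hz => charPoly_ne_zero_of_mem_range hmem hz

/-- If two entries differ, partial fractions give a multiple of the difference of two integrals for
vectors one entry shorter; these have equal length, so they cancel by induction. If all entries
agree, the integrand is a single power of $(z-\mu)^{-1}$, with a primitive unless the exponent is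
one. -/
theorem IsPiecewiseC1.contourIntegral_inv_charPoly {a : ℂ} {Γ : Path a a}
    (h : IsPiecewiseC1 Γ) (Λ : Multiset ℝ) (hΛ : Λ ≠ 0) (hmem : ∀ μ ∈ Λ, (μ : ℂ) ∉ range Γ)
    (hw : ∀ μ ∈ Λ, windingNumber Γ (μ : ℂ) = 1) :
    (2 * Real.pi * Complex.I)⁻¹ * contourIntegral (fun z => (charPoly Λ z)⁻¹) Γ =
      if Λ.card = 1 then 1 else 0 := by
  induction hn : Λ.card using Nat.strong_induction_on generalizing Λ with
  | _ n ih =>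
  obtain ⟨μ, hμ⟩ := Multiset.exists_mem_of_ne_zero hΛ
  by_cases hall : ∀ ν ∈ Λ, ν = μ
  · have hrep : Λ = Multiset.replicate n μ := Multiset.eq_replicate.2 ⟨hn, hall⟩
    have hc : ∀ z, (charPoly Λ z)⁻¹ = ((z - μ) ^ n)⁻¹ := by
      intro z
      rw [hrep, charPoly, Multiset.map_replicate, Multiset.prod_replicate]
    simp only [hc]
    have hn0 : n ≠ 0 := by
      rintro rfl
      exact hΛ (Multiset.card_eq_zero.1 hn)
    split_ifs with h1
    · subst h1
      simpa [windingNumber] using hw μ hμ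
    · have hne : ∀ z ∈ range Γ, z - (μ : ℂ) ≠ 0 := fun z hz h =>
        hmem μ hμ (sub_eq_zero.1 h ▸ hz)
      obtain ⟨m, rfl⟩ : ∃ m, n = m + 2 := ⟨n - 2, by omega⟩
      rw [h.contourIntegral_eq_zero_of_hasDerivAt
        (F := fun z => (-((m : ℂ) + 1)⁻¹) * ((z - μ) ^ (m + 1))⁻¹), mul_zero]
      · exact ContinuousOn.inv₀ (by fun_prop) fun z hz => pow_ne_zero _ (hne z hz)
      · intro z hz
        have hz0 := hne z hz
        have hm : (m : ℂ) + 1 ≠ 0 := Nat.cast_add_one_ne_zero m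
        have := ((((hasDerivAt_id z).sub_const (μ : ℂ)).pow (m + 1)).inv
          (pow_ne_zero _ hz0)).const_mul (-((m : ℂ) + 1)⁻¹)
        refine this.congr_deriv ?_
        simp only [Pi.pow_apply, id]
        push_cast
        field_simp
        ring
  · push Not at hall
    obtain ⟨ν, hν, hne⟩ := hall
    obtain ⟨Λ₁, rfl⟩ := Multiset.exists_cons_of_mem hμ
    obtain ⟨Λ₂, rfl⟩ :=
      Multiset.exists_cons_of_mem ((Multiset.mem_cons.1 hν).resolve_left hne)
    simp only [Multiset.card_cons] at hn
    have hsub1 : ∀ x ∈ μ ::ₘ Λ₂, x ∈ μ ::ₘ ν ::ₘ Λ₂ := by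
      intro x hx; simp only [Multiset.mem_cons] at hx ⊢; tauto
    have hsub2 : ∀ x ∈ ν ::ₘ Λ₂, x ∈ μ ::ₘ ν ::ₘ Λ₂ := fun x hx => Multiset.mem_cons_of_mem hx
    have ih1 := ih (Λ₂.card + 1) (by omega) (μ ::ₘ Λ₂) (Multiset.cons_ne_zero)
      (fun x hx => hmem x (hsub1 x hx)) (fun x hx => hw x (hsub1 x hx)) (by simp)
    have ih2 := ih (Λ₂.card + 1) (by omega) (ν ::ₘ Λ₂) (Multiset.cons_ne_zero)
      (fun x hx => hmem x (hsub2 x hx)) (fun x hx => hw x (hsub2 x hx)) (by simp)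
    have hd : (μ : ℂ) - ν ≠ 0 := sub_ne_zero.2 (by exact_mod_cast hne.symm)
    have hcong : EqOn (fun z => (charPoly (μ ::ₘ ν ::ₘ Λ₂) z)⁻¹)
        (fun z => ((μ : ℂ) - ν)⁻¹ * ((charPoly (μ ::ₘ Λ₂) z)⁻¹ - (charPoly (ν ::ₘ Λ₂) z)⁻¹))
        (range Γ) := by
      intro z hz
      have h1 := charPoly_ne_zero_of_mem_range hmem hz
      simp only [charPoly_cons, mul_ne_zero_iff] at h1 ⊢
      obtain ⟨h1, h2, h3⟩ := h1
      field_simp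
      ring
    rw [contourIntegral_congr hcong, contourIntegral_const_mul,
      h.contourIntegral_sub (continuousOn_inv_charPoly fun x hx => hmem x (hsub1 x hx))
        (continuousOn_inv_charPoly fun x hx => hmem x (hsub2 x hx)),
      mul_left_comm, mul_sub, ih1, ih2, sub_self, mul_zero, if_neg (by omega)]

/-! ### The differential equation satisfied by `A` -/

theorem IsPiecewiseC1.hasDerivAt_contourIntegral_mul_exp {a : ℂ} {Γ : Path a a}
    (h : IsPiecewiseC1 Γ) {φ : ℂ → ℂ} (hφ : ContinuousOn φ (range Γ)) (x : ℝ) :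
    HasDerivAt (fun x : ℝ => contourIntegral (fun z => φ z * Complex.exp (x * z)) Γ)
      (contourIntegral (fun z => φ z * (z * Complex.exp (x * z))) Γ) x := by
  simp only [contourIntegral_eq_intervalIntegral]
  set d := derivWithin Γ.extend (Icc 0 1)
  have hK : IsCompact (range Γ) := isCompact_range Γ.continuous
  obtain ⟨C, hC⟩ := hK.exists_bound_of_continuousOn hφ
  obtain ⟨R, hR⟩ := hK.exists_bound_of_continuousOn (f := id) continuousOn_id
  have hmeas : ∀ {f : ℂ → ℂ}, ContinuousOn f (range Γ) →
      AEStronglyMeasurable (fun t => f (Γ.extend t) * d t) (volume.restrict (uIoc 0 1)) :=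
    fun hf => (intervalIntegrable_iff.1 (h.intervalIntegrable_mul hf)).aestronglyMeasurable
  have hc : ∀ x : ℝ, ContinuousOn (fun z => φ z * Complex.exp (x * z)) (range Γ) := fun x =>
    hφ.mul (by fun_prop)
  have hc' : ContinuousOn (fun z => φ z * (z * Complex.exp (x * z))) (range Γ) :=
    hφ.mul (by fun_prop)
  refine (intervalIntegral.hasDerivAt_integral_of_dominated_loc_of_deriv_le
    (F' := fun (x : ℝ) t => φ (Γ.extend t) * (Γ.extend t * Complex.exp (x * Γ.extend t)) * d t)
    (bound := fun t => C * (R * Real.exp ((|x| + 1) * R)) * ‖d t‖)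
    (Metric.ball_mem_nhds x one_pos)
    (Filter.Eventually.of_forall fun y => hmeas (hc y)) (h.intervalIntegrable_mul (hc x))
    (hmeas hc') ?_ (h.intervalIntegrable.norm.const_mul _) ?_).2
  · refine Filter.Eventually.of_forall fun t _ y hy => ?_
    have h1 := hC _ (extend_mem_range Γ t)
    have h2 : ‖Γ.extend t‖ ≤ R := hR _ (extend_mem_range Γ t)
    have hC0 : 0 ≤ C := (norm_nonneg _).trans h1
    have hR0 : 0 ≤ R := (norm_nonneg _).trans h2
    have hy' : |y| ≤ |x| + 1 := by
      rw [Metric.mem_ball, Real.dist_eq] at hy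
      have := abs_sub_abs_le_abs_sub y x
      linarith
    rw [norm_mul, norm_mul, norm_mul, Complex.norm_exp]
    have h3 : ((y : ℂ) * Γ.extend t).re ≤ (|x| + 1) * R := by
      refine (Complex.re_le_norm _).trans ?_
      rw [norm_mul, Complex.norm_real, Real.norm_eq_abs]
      gcongr
    gcongr
  · refine Filter.Eventually.of_forall fun t _ y _ => ?_
    have h1 : HasDerivAt (fun y : ℝ => (y : ℂ) * Γ.extend t) (Γ.extend t) y := by
      simpa using (Complex.ofRealCLM.hasDerivAt (x := y)).mul_const (Γ.extend t)
    have h2 := ((h1.cexp).const_mul (φ (Γ.extend t))).mul_const (d t)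
    exact h2.congr_deriv (by ring)

theorem IsAdmissible.of_le {Λ Λ' : Multiset ℝ} {lam a : ℂ} {Γ : Path a a}
    (h : IsAdmissible Λ lam Γ) (hle : Λ' ≤ Λ) : IsAdmissible Λ' lam Γ where
  piecewiseC1 := h.piecewiseC1
  notMem_of_mem μ hμ := h.notMem_of_mem μ (Multiset.mem_of_le hle hμ)
  winding_eq_one μ hμ := h.winding_eq_one μ (Multiset.mem_of_le hle hμ)
  notMem_of_exp_eq := h.notMem_of_exp_eq
  winding_eq_zero := h.winding_eq_zero

theorem IsAdmissible.exp_sub_ne_zero {Λ : Multiset ℝ} {lam a : ℂ} {Γ : Path a a}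
    (h : IsAdmissible Λ lam Γ) {z : ℂ} (hz : z ∈ range Γ) : Complex.exp z - lam ≠ 0 :=
  fun h0 => h.notMem_of_exp_eq z (sub_eq_zero.1 h0) hz

theorem IsAdmissible.continuousOn_weight {Λ : Multiset ℝ} {lam a : ℂ} {Γ : Path a a}
    (h : IsAdmissible Λ lam Γ) :
    ContinuousOn (fun z => (charPoly Λ z)⁻¹ * (Complex.exp z - lam)⁻¹) (range Γ) :=
  (continuousOn_inv_charPoly h.notMem_of_mem).mul
    (ContinuousOn.inv₀ (by fun_prop) fun _ hz => h.exp_sub_ne_zero hz)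

theorem IsAdmissible.continuousOn_integrand {Λ : Multiset ℝ} {lam a : ℂ} {Γ : Path a a}
    (h : IsAdmissible Λ lam Γ) (x : ℝ) :
    ContinuousOn (fun z => (charPoly Λ z)⁻¹ * (Complex.exp z - lam)⁻¹ * Complex.exp (x * z))
      (range Γ) :=
  h.continuousOn_weight.mul (by fun_prop)

theorem A_eq (Λ : Multiset ℝ) (x : ℝ) (lam : ℂ) {a : ℂ} (Γ : Path a a) :
    A Λ x lam Γ = (2 * Real.pi * Complex.I)⁻¹ * contourIntegral
      (fun z => (charPoly Λ z)⁻¹ * (Complex.exp z - lam)⁻¹ * Complex.exp (x * z)) Γ := by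
  rw [A]
  congr 2
  ext z
  ring

theorem IsAdmissible.hasDerivAt_A {μ : ℝ} {Λ : Multiset ℝ} {lam a : ℂ} {Γ : Path a a}
    (h : IsAdmissible (μ ::ₘ Λ) lam Γ) (x : ℝ) :
    HasDerivAt (fun x => A (μ ::ₘ Λ) x lam Γ) (μ * A (μ ::ₘ Λ) x lam Γ + A Λ x lam Γ) x := by
  have h' : IsAdmissible Λ lam Γ := h.of_le (Multiset.le_cons_self Λ μ)
  simp only [A_eq]
  refine ((h.piecewiseC1.hasDerivAt_contourIntegral_mul_exp h.continuousOn_weight x).const_mul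
    (2 * Real.pi * Complex.I)⁻¹).congr_deriv ?_
  have hcong : EqOn
      (fun z => (charPoly (μ ::ₘ Λ) z)⁻¹ * (Complex.exp z - lam)⁻¹ * (z * Complex.exp (x * z)))
      (fun z => μ * ((charPoly (μ ::ₘ Λ) z)⁻¹ * (Complex.exp z - lam)⁻¹ * Complex.exp (x * z)) +
        (charPoly Λ z)⁻¹ * (Complex.exp z - lam)⁻¹ * Complex.exp (x * z)) (range Γ) := by
    intro z hz
    have h1 := charPoly_ne_zero_of_mem_range h.notMem_of_mem hz
    simp only [charPoly_cons, mul_ne_zero_iff] at h1 ⊢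
    obtain ⟨h1, h2⟩ := h1
    have h3 := h.exp_sub_ne_zero hz
    field_simp
    ring
  rw [contourIntegral_congr hcong, h.piecewiseC1.contourIntegral_add
    (f := fun z => μ *
      ((charPoly (μ ::ₘ Λ) z)⁻¹ * (Complex.exp z - lam)⁻¹ * Complex.exp (x * z)))
    (continuousOn_const.mul (h.continuousOn_integrand x)) (h'.continuousOn_integrand x),
    contourIntegral_const_mul]
  ring

/-- In the difference the factor $e^z-\lambda$ cancels, leaving the integral of $1/L_\Lambda$. -/
theorem IsAdmissible.A_one_sub {Λ : Multiset ℝ} {lam a : ℂ} {Γ : Path a a}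
    (h : IsAdmissible Λ lam Γ) (hΛ : Λ ≠ 0) :
    A Λ 1 lam Γ - lam * A Λ 0 lam Γ = if Λ.card = 1 then 1 else 0 := by
  rw [← h.piecewiseC1.contourIntegral_inv_charPoly Λ hΛ h.notMem_of_mem h.winding_eq_one]
  simp only [A_eq]
  rw [mul_left_comm, ← mul_sub, ← contourIntegral_const_mul, ← h.piecewiseC1.contourIntegral_sub
    (h.continuousOn_integrand 1)
    (g := fun z => lam *
      ((charPoly Λ z)⁻¹ * (Complex.exp z - lam)⁻¹ * Complex.exp ((0 : ℝ) * z)))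
    (continuousOn_const.mul (h.continuousOn_integrand 0))]
  congr 1
  refine contourIntegral_congr fun z hz => ?_
  have h1 := charPoly_ne_zero_of_mem_range h.notMem_of_mem hz
  have h3 := h.exp_sub_ne_zero hz
  simp only [Complex.ofReal_one, one_mul, Complex.ofReal_zero, zero_mul, Complex.exp_zero]
  field_simp

theorem IsAdmissible.A_zero {lam a : ℂ} {Γ : Path a a} (h : IsAdmissible 0 lam Γ) (x : ℝ) :
    A 0 x lam Γ = 0 := by
  have := h.piecewiseC1.contourIntegral_div_exp_sub_eq_zero h.notMem_of_exp_eq h.winding_eq_zero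
    (g := fun z => Complex.exp (x * z)) (by fun_prop)
  simp [A, charPoly_zero, this]

/-! ### A recursion for `r * A` -/

/-- The function `(x, lam) ↦ (-1) ^ l.length * Π(x; lam)` of the vector with entries `ν` and those
of `l`, defined by recursion on `l`. -/
noncomputable def signedPi (ν : ℝ) : List ℝ → ℝ → ℂ → ℂ
  | [] => fun x _ => (Real.exp (ν * x) : ℂ)
  | μ :: l => fun x lam => (Real.exp (μ * (1 + x)) : ℂ) *
      ((∫ s in x..1, (Real.exp (-(μ * s)) : ℂ) * signedPi ν l s lam) +
        lam * (Real.exp (-μ) : ℂ) * ∫ s in (0 : ℝ)..x, (Real.exp (-(μ * s)) : ℂ) * signedPi ν l s lam)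

theorem exp_mul_sub_eq_integral {μ : ℝ} {f h : ℝ → ℂ} (hh : Continuous h)
    (hf : ∀ x, HasDerivAt f (μ * f x + h x) x) (x y : ℝ) :
    ∫ s in x..y, (Real.exp (-(μ * s)) : ℂ) * h s =
      Real.exp (-(μ * y)) * f y - Real.exp (-(μ * x)) * f x := by
  refine intervalIntegral.integral_eq_sub_of_hasDerivAt
    (f := fun s => (Real.exp (-(μ * s)) : ℂ) * f s) (fun s _ => ?_)
    (Continuous.intervalIntegrable (by fun_prop) _ _)
  have h1 : HasDerivAt (fun s : ℝ => Real.exp (-(μ * s))) (Real.exp (-(μ * s)) * -(μ * 1)) s :=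
    (((hasDerivAt_id s).const_mul μ).neg).exp
  refine (h1.ofReal_comp.mul (hf s)).congr_deriv ?_
  push_cast
  ring

theorem IsAdmissible.continuous_A {Λ : Multiset ℝ} {lam a : ℂ} {Γ : Path a a}
    (h : IsAdmissible Λ lam Γ) : Continuous fun x => A Λ x lam Γ := by
  simp only [A_eq]
  exact continuous_const.mul (continuous_iff_continuousAt.2 fun x =>
    (h.piecewiseC1.hasDerivAt_contourIntegral_mul_exp h.continuousOn_weight x).continuousAt)

theorem r_cons (μ : ℝ) (Λ : Multiset ℝ) (lam : ℂ) :
    r (μ ::ₘ Λ) lam = (Complex.exp μ - lam) * r Λ lam := by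
  simp [r]

/-- For $f'=\mu f+h$ with $f(1)=\lambda f(0)$, integrating $(e^{-\mu s}f)'=e^{-\mu s}h$ over $[x,1]$
and $[0,x]$ and eliminating $f(0),f(1)$ gives
$(e^\mu-\lambda)f(x)=-e^{\mu(1+x)}\bigl(\int_x^1e^{-\mu s}h\,ds+\lambda e^{-\mu}\int_0^xe^{-\mu
s}h\,ds\bigr)$. This accounts for the factor of `r` and the sign gained at each entry. -/
theorem IsAdmissible.r_mul_A_eq {ν : ℝ} {l : List ℝ} {lam a : ℂ} {Γ : Path a a}
    (h : IsAdmissible (ν ::ₘ (l : Multiset ℝ)) lam Γ) (x : ℝ) :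
    r (ν ::ₘ (l : Multiset ℝ)) lam * A (ν ::ₘ (l : Multiset ℝ)) x lam Γ =
      (-1) ^ l.length * signedPi ν l x lam := by
  induction l generalizing x with
  | nil =>
    simp only [Multiset.coe_nil] at h ⊢
    have h0 : IsAdmissible 0 lam Γ := h.of_le (Multiset.zero_le _)
    have hA := exp_mul_sub_eq_integral h0.continuous_A h.hasDerivAt_A
    have h1 := h.A_one_sub Multiset.cons_ne_zero
    have e1 := hA 0 1
    have e2 := hA 0 x
    simp only [h0.A_zero, mul_zero, intervalIntegral.integral_zero, neg_zero, Real.exp_zero,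
      Complex.ofReal_one, one_mul, mul_one] at e1 e2
    simp only [Multiset.card_cons, Multiset.card_zero, zero_add, if_true] at h1
    simp only [r_cons, signedPi, List.length_nil, pow_zero, one_mul]
    have hr : r 0 lam = 1 := by simp [r]
    have hx : (Real.exp (ν * x) : ℂ) * Real.exp (-(ν * x)) = 1 := by
      rw [← Complex.ofReal_mul, ← Real.exp_add, add_neg_cancel, Real.exp_zero, Complex.ofReal_one]
    have hν : (Complex.exp ν) * Real.exp (-ν) = 1 := by
      rw [← Complex.ofReal_exp, ← Complex.ofReal_mul, ← Real.exp_add, add_neg_cancel,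
        Real.exp_zero, Complex.ofReal_one]
    rw [hr]
    linear_combination (-(A (ν ::ₘ 0) x lam Γ) * (Complex.exp ν - lam)) * hx
      + Real.exp (ν * x) * h1 - Real.exp (ν * x) * (Complex.exp ν - lam) * e2
      + Real.exp (ν * x) * Complex.exp ν * e1 + Real.exp (ν * x) * A (ν ::ₘ 0) 1 lam Γ * hν
  | cons μ l ih =>
    have hswap : ν ::ₘ ((μ :: l : List ℝ) : Multiset ℝ) = μ ::ₘ ν ::ₘ (l : Multiset ℝ) := by
      rw [← Multiset.cons_coe, Multiset.cons_swap]
    rw [hswap] at h ⊢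
    set Λ : Multiset ℝ := ν ::ₘ (l : Multiset ℝ) with hΛ
    have h0 : IsAdmissible Λ lam Γ := h.of_le (Multiset.le_cons_self Λ μ)
    have hA := exp_mul_sub_eq_integral h0.continuous_A h.hasDerivAt_A
    have h1 := h.A_one_sub Multiset.cons_ne_zero
    -- There are now at least two entries, so the boundary relation is homogeneous.
    rw [if_neg (by simp [hΛ])] at h1
    have hint : ∀ u v : ℝ, r Λ lam * ∫ s in u..v, (Real.exp (-(μ * s)) : ℂ) * A Λ s lam Γ =
        (-1) ^ l.length * ∫ s in u..v, (Real.exp (-(μ * s)) : ℂ) * signedPi ν l s lam := by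
      intro u v
      rw [← intervalIntegral.integral_const_mul, ← intervalIntegral.integral_const_mul]
      refine intervalIntegral.integral_congr fun s _ => ?_
      simp only [mul_left_comm _ (Real.exp (-(μ * s)) : ℂ), ih h0 s]
    have i1 := hint x 1
    have i2 := hint 0 x
    rw [hA] at i1 i2
    simp only [mul_one, mul_zero, neg_zero, Real.exp_zero, Complex.ofReal_one, one_mul] at i1 i2
    have hx : (Real.exp (μ * x) : ℂ) * Real.exp (-(μ * x)) = 1 := by
      rw [← Complex.ofReal_mul, ← Real.exp_add, add_neg_cancel, Real.exp_zero, Complex.ofReal_one]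
    have hμ : (Complex.exp μ) * Real.exp (-μ) = 1 := by
      rw [← Complex.ofReal_exp, ← Complex.ofReal_mul, ← Real.exp_add, add_neg_cancel,
        Real.exp_zero, Complex.ofReal_one]
    have hx1 : (Real.exp (μ * (1 + x)) : ℂ) = Complex.exp μ * Real.exp (μ * x) := by
      rw [mul_add, mul_one, Real.exp_add, Complex.ofReal_mul, Complex.ofReal_exp]
    simp only [r_cons, signedPi, List.length_cons, pow_succ, hx1]
    generalize (∫ s in x..1, (Real.exp (-(μ * s)) : ℂ) * signedPi ν l s lam) = I1 at i1 ⊢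
    generalize (∫ s in (0 : ℝ)..x, (Real.exp (-(μ * s)) : ℂ) * signedPi ν l s lam) = I0 at i2 ⊢
    generalize (Real.exp (-μ) : ℂ) = b at *
    generalize (Real.exp (-(μ * x)) : ℂ) = d at *
    generalize (Real.exp (μ * x) : ℂ) = c at *
    generalize Complex.exp μ = e at *
    generalize A (μ ::ₘ Λ) x lam Γ = fx at *
    generalize A (μ ::ₘ Λ) 1 lam Γ = f1 at *
    generalize A (μ ::ₘ Λ) 0 lam Γ = f0 at *
    generalize r Λ lam = R at *
    generalize ((-1 : ℂ) ^ l.length) = σ at *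
    linear_combination (-(c * e)) * i1 - c * lam * i2 - (e - lam) * R * fx * hx
      + (c * R * f1 + lam * c * σ * I0) * hμ + c * R * h1

/-- A family of functions of `lam`, indexed by `x`, that is polynomial in `lam` with real
coefficients continuous in `x`. -/
def IsPolynomialFamily (f : ℝ → ℂ → ℂ) : Prop :=
  ∃ (n : ℕ) (e : Fin n → ℕ) (c : Fin n → ℝ → ℝ), (∀ j, Continuous (c j)) ∧
    ∀ x lam, f x lam = ∑ j, (c j x : ℂ) * lam ^ e j

theorem IsPolynomialFamily.add {f g : ℝ → ℂ → ℂ} (hf : IsPolynomialFamily f)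
    (hg : IsPolynomialFamily g) : IsPolynomialFamily fun x lam => f x lam + g x lam := by
  obtain ⟨n, e, c, hc, hf⟩ := hf
  obtain ⟨n', e', c', hc', hg⟩ := hg
  refine ⟨n + n', Fin.append e e', Fin.append c c', fun j => ?_, fun x lam => ?_⟩
  · refine Fin.addCases (fun i => ?_) (fun i => ?_) j
    · simpa using hc i
    · simpa using hc' i
  · simp [Fin.sum_univ_add, hf, hg]

theorem IsPolynomialFamily.mul_left {f : ℝ → ℂ → ℂ} (hf : IsPolynomialFamily f) {w : ℝ → ℝ}
    (hw : Continuous w) : IsPolynomialFamily fun x lam => w x * f x lam := by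
  obtain ⟨n, e, c, hc, hf⟩ := hf
  refine ⟨n, e, fun j x => w x * c j x, fun j => hw.mul (hc j), fun x lam => ?_⟩
  simp [hf, Finset.mul_sum, mul_assoc]

theorem IsPolynomialFamily.lam_mul {f : ℝ → ℂ → ℂ} (hf : IsPolynomialFamily f) :
    IsPolynomialFamily fun x lam => lam * f x lam := by
  obtain ⟨n, e, c, hc, hf⟩ := hf
  refine ⟨n, fun j => e j + 1, c, hc, fun x lam => ?_⟩
  simp only [hf, Finset.mul_sum]
  exact Finset.sum_congr rfl fun j _ => by ring

theorem IsPolynomialFamily.integral {f : ℝ → ℂ → ℂ} (hf : IsPolynomialFamily f) (y : ℝ) :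
    IsPolynomialFamily fun x lam => ∫ s in y..x, f s lam := by
  obtain ⟨n, e, c, hc, hf⟩ := hf
  refine ⟨n, e, fun j x => ∫ s in y..x, c j s, fun j =>
    intervalIntegral.continuous_primitive (fun _ _ => (hc j).intervalIntegrable _ _) y,
    fun x lam => ?_⟩
  simp only [hf]
  rw [intervalIntegral.integral_finsetSum]
  · simp [intervalIntegral.integral_mul_const, intervalIntegral.integral_ofReal]
  · intro j _
    have := hc j
    exact Continuous.intervalIntegrable (by fun_prop) _ _

theorem IsPolynomialFamily.conj {f : ℝ → ℂ → ℂ} (hf : IsPolynomialFamily f) (x : ℝ) (lam : ℂ) :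
    f x (starRingEnd ℂ lam) = starRingEnd ℂ (f x lam) := by
  obtain ⟨n, e, c, hc, hf⟩ := hf
  simp [hf]

theorem IsPolynomialFamily.exists_polynomial {f : ℝ → ℂ → ℂ} (hf : IsPolynomialFamily f)
    (x : ℝ) : ∃ P : ℂ[X], ∀ lam, P.eval lam = f x lam := by
  obtain ⟨n, e, c, hc, hf⟩ := hf
  refine ⟨∑ j, Polynomial.C (c j x : ℂ) * Polynomial.X ^ e j, fun lam => ?_⟩
  simp [hf, Polynomial.eval_finsetSum]

theorem isPolynomialFamily_signedPi (ν : ℝ) (l : List ℝ) : IsPolynomialFamily (signedPi ν l) := by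
  induction l with
  | nil =>
    exact ⟨1, fun _ => 0, fun _ x => Real.exp (ν * x), fun _ => by fun_prop, by simp [signedPi]⟩
  | cons μ l ih =>
    have hw : IsPolynomialFamily fun s lam => (Real.exp (-(μ * s)) : ℂ) * signedPi ν l s lam :=
      ih.mul_left (w := fun s => Real.exp (-(μ * s))) (by fun_prop)
    -- The factor $-1$ turns $\int_1^x$ into the $\int_x^1$ of the recursion.
    have h1 := (hw.integral 1).mul_left (w := fun _ => -1) continuous_const
    have h2 := ((hw.integral 0).mul_left (w := fun _ => Real.exp (-μ)) continuous_const).lam_mul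
    have h3 := (h1.add h2).mul_left (w := fun x => Real.exp (μ * (1 + x))) (by fun_prop)
    convert h3 using 3 with x lam
    rw [signedPi, intervalIntegral.integral_symm]
    push_cast
    ring

open scoped ComplexConjugate

/-! ### Zeros of `signedPi` -/

/-- Extended to the real line by `w (x + 1) = ρ * w x`, the function `w` on `[0, 1]` does not
vanish and turns counterclockwise, by less than a half-turn over each unit interval. -/
structure IsTurning (ρ : ℂ) (w : ℝ → ℂ) : Prop where
  continuous : Continuous w
  im_nonneg : ∀ x ∈ Icc (0 : ℝ) 1, ∀ y ∈ Icc (0 : ℝ) 1, x ≤ y → 0 ≤ (conj (w x) * w y).im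
  im_nonneg' : ∀ x ∈ Icc (0 : ℝ) 1, ∀ y ∈ Icc (0 : ℝ) 1, y ≤ x →
    0 ≤ (conj (w x) * (ρ * w y)).im
  ne_zero : ∀ x ∈ Icc (0 : ℝ) 1, w x ≠ 0

/-- Positive real factors do not change arguments, so `k` and `g` need not be related. -/
theorem IsTurning.smul {ρ : ℂ} {w : ℝ → ℂ} (h : IsTurning ρ w) {k : ℝ} (hk : 0 < k)
    {g : ℝ → ℝ} (hg : Continuous g) (hg0 : ∀ x, 0 < g x) :
    IsTurning (k * ρ) fun x => g x * w x where
  continuous := by have := h.continuous; fun_prop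
  im_nonneg x hx y hy hxy := by
    have : conj (g x * w x) * (g y * w y) = ((g x * g y : ℝ) : ℂ) * (conj (w x) * w y) := by
      simp only [map_mul, Complex.conj_ofReal]; push_cast; ring
    rw [this, Complex.im_ofReal_mul]
    exact mul_nonneg (mul_pos (hg0 x) (hg0 y)).le (h.im_nonneg x hx y hy hxy)
  im_nonneg' x hx y hy hxy := by
    have : conj (g x * w x) * (k * ρ * (g y * w y)) =
        ((g x * g y * k : ℝ) : ℂ) * (conj (w x) * (ρ * w y)) := by
      simp only [map_mul, Complex.conj_ofReal]; push_cast; ring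
    rw [this, Complex.im_ofReal_mul]
    exact mul_nonneg (mul_pos (mul_pos (hg0 x) (hg0 y)) hk).le (h.im_nonneg' x hx y hy hxy)
  ne_zero x hx := mul_ne_zero (Complex.ofReal_ne_zero.2 (hg0 x).ne') (h.ne_zero x hx)

theorem im_mul_integral {f : ℝ → ℂ} (hf : Continuous f) (κ : ℂ) (a b : ℝ) :
    (κ * ∫ s in a..b, f s).im = ∫ s in a..b, (κ * f s).im := by
  rw [← intervalIntegral.integral_const_mul]
  exact (Complex.imCLM.intervalIntegral_comp_comm
    (Continuous.intervalIntegrable (by fun_prop) a b)).symm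

theorem im_mul_integral_nonneg {f : ℝ → ℂ} (hf : Continuous f) {κ : ℂ} {a b : ℝ} (hab : a ≤ b)
    (h : ∀ s ∈ Icc a b, 0 ≤ (κ * f s).im) : 0 ≤ (κ * ∫ s in a..b, f s).im := by
  rw [im_mul_integral hf]
  exact intervalIntegral.integral_nonneg hab h

theorem im_mul_integral_pos {f : ℝ → ℂ} (hf : Continuous f) {κ : ℂ} {a b : ℝ} (hab : a < b)
    (h : ∀ s ∈ Icc a b, 0 ≤ (κ * f s).im) (h' : ∃ s ∈ Icc a b, 0 < (κ * f s).im) :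
    0 < (κ * ∫ s in a..b, f s).im := by
  rw [im_mul_integral hf]
  have hc : Continuous fun s => (κ * f s).im := Complex.continuous_im.comp (by fun_prop)
  exact intervalIntegral.integral_pos hab hc.continuousOn
    (fun s hs => h s (Ioc_subset_Icc_self hs)) h'

theorem im_conj_mul_comm (u v : ℂ) : (conj u * v).im = (-conj v * u).im := by
  simp only [Complex.mul_im, Complex.conj_re, Complex.conj_im, Complex.neg_re, Complex.neg_im]
  ring

theorem im_conj_integral_mul_integral_nonneg {f g : ℝ → ℂ} (hf : Continuous f)
    (hg : Continuous g) {a b c d : ℝ} (hab : a ≤ b) (hcd : c ≤ d) (σ : ℂ)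
    (h : ∀ s ∈ Icc a b, ∀ t ∈ Icc c d, 0 ≤ (conj (f s) * (σ * g t)).im) :
    0 ≤ (conj (∫ s in a..b, f s) * (σ * ∫ t in c..d, g t)).im := by
  rw [← mul_assoc]
  refine im_mul_integral_nonneg hg hcd fun t ht => ?_
  rw [mul_assoc, im_conj_mul_comm]
  refine im_mul_integral_nonneg hf hab fun s hs => ?_
  rw [← im_conj_mul_comm]
  exact h s hs t ht

/-- With $w(x+1)=\rho w(x)$, the new function is $\int_x^{x+1}w$, and it has the same multiplier. -/
theorem IsTurning.integral {ρ : ℂ} (hρ : 0 < ρ.im) {w : ℝ → ℂ} (h : IsTurning ρ w) :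
    IsTurning ρ fun x => (∫ s in x..1, w s) + ρ * ∫ s in (0 : ℝ)..x, w s := by
  have hint : ∀ a b, IntervalIntegrable w volume a b :=
    fun a b => h.continuous.intervalIntegrable a b
  -- Cut $[0,1]$ at $x\le y$ into pieces with integrals `a₀`, `a`, `b`; the order of the pieces
  -- fixes the signs of their cross products.
  have key : ∀ x y : ℝ, 0 ≤ x → x ≤ y → y ≤ 1 → ∃ a₀ a b : ℂ,
      (∫ s in (0 : ℝ)..x, w s) = a₀ ∧ (∫ s in x..1, w s) = a + b ∧
      (∫ s in (0 : ℝ)..y, w s) = a₀ + a ∧ (∫ s in y..1, w s) = b ∧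
      0 ≤ (conj a₀ * a).im ∧ 0 ≤ (conj a * b).im ∧ 0 ≤ (conj a * (ρ * a₀)).im ∧
      0 ≤ (conj b * (ρ * a)).im := by
    intro x y hx hxy hy
    have h1 := h.im_nonneg
    have h2 := h.im_nonneg'
    refine ⟨_, ∫ s in x..y, w s, _, rfl,
      (intervalIntegral.integral_add_adjacent_intervals (hint _ _) (hint _ _)).symm,
      (intervalIntegral.integral_add_adjacent_intervals (hint _ _) (hint _ _)).symm, rfl,
      ?_, ?_, ?_, ?_⟩
    · simpa using im_conj_integral_mul_integral_nonneg h.continuous h.continuous hx hxy 1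
        fun s hs t ht => by
          simpa using h1 s ⟨hs.1, by linarith [hs.2]⟩ t ⟨by linarith [ht.1], by linarith [ht.2]⟩
            (hs.2.trans ht.1)
    · simpa using im_conj_integral_mul_integral_nonneg h.continuous h.continuous hxy hy 1
        fun s hs t ht => by
          simpa using h1 s ⟨by linarith [hs.1], by linarith [hs.2]⟩ t ⟨by linarith [ht.1], ht.2⟩
            (hs.2.trans ht.1)
    · exact im_conj_integral_mul_integral_nonneg h.continuous h.continuous hxy hx ρ
        fun s hs t ht => h2 s ⟨by linarith [hs.1], by linarith [hs.2]⟩ t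
          ⟨ht.1, by linarith [ht.2]⟩ (ht.2.trans hs.1)
    · exact im_conj_integral_mul_integral_nonneg h.continuous h.continuous hy hxy ρ
        fun s hs t ht => h2 s ⟨by linarith [hs.1], hs.2⟩ t
          ⟨by linarith [ht.1], by linarith [ht.2]⟩ (ht.2.trans hs.1)
  constructor
  · have hc := intervalIntegral.continuous_primitive hint
    have : ∀ x, (∫ s in x..1, w s) = -∫ s in (1 : ℝ)..x, w s :=
      fun x => intervalIntegral.integral_symm _ _
    simp only [this]
    exact (hc 1).neg.add (continuous_const.mul (hc 0))
  · intro x hx y hy hxy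
    obtain ⟨a₀, a, b, e1, e2, e3, e4, p1, p2, p3, p4⟩ := key x y hx.1 hxy hy.2
    -- The windows from `x` and from `y` share `b + ρ * a₀`, which contributes nothing against
    -- itself. The pair `a`, `ρ * a` gives the term with `ρ.im`.
    have : (conj (a + b + ρ * a₀) * (b + ρ * (a₀ + a))).im =
        (conj a * b).im + (conj a * (ρ * a₀)).im + ρ.im * Complex.normSq a
          + (conj b * (ρ * a)).im + Complex.normSq ρ * (conj a₀ * a).im := by
      simp only [Complex.mul_im, Complex.mul_re, Complex.add_re, Complex.add_im, Complex.conj_re,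
        Complex.conj_im, Complex.normSq_apply]
      ring
    simp only [e1, e2, e3, e4, this]
    have := Complex.normSq_nonneg ρ
    have := Complex.normSq_nonneg a
    positivity
  · intro x hx y hy hxy
    obtain ⟨a₀, a, b, e1, e2, e3, e4, p1, p2, p3, p4⟩ := key y x hy.1 hxy hx.2
    -- Here `y ≤ x`, and the windows start at `x` and `y + 1`; they share `ρ * a`.
    have : (conj (b + ρ * (a₀ + a)) * (ρ * (a + b + ρ * a₀))).im =
        (conj b * (ρ * a)).im + Complex.normSq ρ * (conj a₀ * a).im
          + Complex.normSq ρ * ((conj a * b).im + (conj a * (ρ * a₀)).im)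
          + ρ.im * Complex.normSq (b + ρ * a₀) := by
      simp only [Complex.mul_im, Complex.mul_re, Complex.add_re, Complex.add_im, Complex.conj_re,
        Complex.conj_im, Complex.normSq_apply]
      ring
    simp only [e1, e2, e3, e4, this]
    have := Complex.normSq_nonneg ρ
    have := Complex.normSq_nonneg (b + ρ * a₀)
    positivity
  · intro x hx h0
    -- The functional `v ↦ (κ * v).im` is the sum of the cross products of `w x` with `v` and of `v`
    -- with `ρ * w x`. It is nonnegative on the sector between these two vectors, which contains all
    -- values of $w$ on $[x,x+1]$.
    set κ : ℂ := conj (w x) - conj (ρ * w x) with hκ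
    have k1 : ∀ v, (κ * v).im = (conj (w x) * v).im + (conj v * (ρ * w x)).im := by
      intro v
      rw [im_conj_mul_comm v, ← Complex.add_im, hκ]
      ring_nf
    have k2 : ∀ v, (κ * ρ * v).im =
        (conj (w x) * (ρ * v)).im + Complex.normSq ρ * (conj v * w x).im := by
      intro v
      rw [mul_assoc, k1, ← Complex.im_ofReal_mul, ← Complex.mul_conj, map_mul]
      ring_nf
    have hself : (conj (w x) * w x).im = 0 := by
      rw [mul_comm, Complex.mul_conj, Complex.ofReal_im]
    have hpos : 0 < (conj (w x) * (ρ * w x)).im := by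
      have : conj (w x) * (ρ * w x) = (Complex.normSq (w x) : ℂ) * ρ := by
        rw [← Complex.mul_conj]; ring
      rw [this, Complex.im_ofReal_mul]
      exact mul_pos (Complex.normSq_pos.2 (h.ne_zero x hx)) hρ
    have n1 : ∀ s ∈ Icc x 1, 0 ≤ (κ * w s).im := fun s hs => by
      have hs' : s ∈ Icc (0 : ℝ) 1 := ⟨hx.1.trans hs.1, hs.2⟩
      rw [k1]
      exact add_nonneg (h.im_nonneg x hx s hs' hs.1) (h.im_nonneg' s hs' x hx hs.1)
    have n2 : ∀ s ∈ Icc 0 x, 0 ≤ (κ * ρ * w s).im := fun s hs => by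
      have hs' : s ∈ Icc (0 : ℝ) 1 := ⟨hs.1, hs.2.trans hx.2⟩
      rw [k2]
      exact add_nonneg (h.im_nonneg' x hx s hs' hs.2)
        (mul_nonneg (Complex.normSq_nonneg ρ) (h.im_nonneg s hs' x hx hs.2))
    have hzero : (κ * ∫ s in x..1, w s).im + (κ * ρ * ∫ s in (0 : ℝ)..x, w s).im = 0 := by
      rw [← Complex.add_im, mul_assoc, ← mul_add, h0, mul_zero, Complex.zero_im]
    have m1 := im_mul_integral_nonneg h.continuous hx.2 n1
    have m2 := im_mul_integral_nonneg h.continuous hx.1 n2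
    -- Strict positivity comes from an end of the window: its start $x$ if $x<1$. If $x=1$ the first
    -- integral is degenerate, and the other end $x+1$ serves.
    rcases hx.2.lt_or_eq with hlt | heq
    · have := im_mul_integral_pos h.continuous hlt n1
        ⟨x, ⟨le_rfl, hx.2⟩, by rw [k1, hself, zero_add]; exact hpos⟩
      linarith
    · have := im_mul_integral_pos h.continuous (show (0 : ℝ) < x by linarith) n2
        ⟨x, ⟨hx.1, le_rfl⟩, by rw [k2, hself, mul_zero, add_zero]; exact hpos⟩
      linarith

theorem isTurning_signedPi (ν : ℝ) (l : List ℝ) {lam : ℂ} (hlam : 0 < lam.im) :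
    IsTurning lam fun x => signedPi ν l x lam := by
  induction l with
  | nil =>
    have h1 : IsTurning lam fun _ => 1 :=
      ⟨continuous_const, by simp, by simpa using fun _ _ _ _ _ _ _ => hlam.le, by simp⟩
    have := h1.smul one_pos (g := fun x => Real.exp (ν * x)) (by fun_prop)
      fun x => Real.exp_pos _
    simpa [signedPi] using this
  | cons μ l ih =>
    have h1 := ih.smul (Real.exp_pos (-μ)) (g := fun x => Real.exp (-(μ * x))) (by fun_prop)
      fun x => Real.exp_pos _
    have hρ : 0 < ((Real.exp (-μ) : ℂ) * lam).im := by
      rw [Complex.im_ofReal_mul]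
      exact mul_pos (Real.exp_pos _) hlam
    have h2 := (h1.integral hρ).smul (Real.exp_pos μ) (g := fun x => Real.exp (μ * (1 + x)))
      (by fun_prop) fun x => Real.exp_pos _
    rw [← mul_assoc, ← Complex.ofReal_mul, ← Real.exp_add, add_neg_cancel, Real.exp_zero,
      Complex.ofReal_one, one_mul] at h2
    simpa only [signedPi, mul_comm lam] using h2

theorem signedPi_ofReal_pos (ν : ℝ) (l : List ℝ) {σ : ℝ} (hσ : 0 < σ) :
    ∃ q : ℝ → ℝ, Continuous q ∧ (∀ x, signedPi ν l x σ = q x) ∧ ∀ x ∈ Icc (0 : ℝ) 1, 0 < q x := by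
  induction l with
  | nil => exact ⟨fun x => Real.exp (ν * x), by fun_prop, fun x => rfl, fun x _ => Real.exp_pos _⟩
  | cons μ l ih =>
    obtain ⟨q, hq, hqe, hq0⟩ := ih
    set w : ℝ → ℝ := fun s => Real.exp (-(μ * s)) * q s with hw
    have hwc : Continuous w := by fun_prop
    have hint : ∀ a b, IntervalIntegrable w volume a b := fun a b => hwc.intervalIntegrable a b
    have hw0 : ∀ x ∈ Icc (0 : ℝ) 1, 0 < w x := fun x hx => mul_pos (Real.exp_pos _) (hq0 x hx)
    refine ⟨fun x => Real.exp (μ * (1 + x)) *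
      ((∫ s in x..1, w s) + σ * Real.exp (-μ) * ∫ s in (0 : ℝ)..x, w s), ?_, ?_, ?_⟩
    · have hc := intervalIntegral.continuous_primitive hint
      have : ∀ x, (∫ s in x..1, w s) = -∫ s in (1 : ℝ)..x, w s :=
        fun x => intervalIntegral.integral_symm _ _
      simp only [this]
      have := hc 0
      have := hc 1
      fun_prop
    · intro x
      simp only [signedPi, hqe, hw]
      push_cast
      simp only [← intervalIntegral.integral_ofReal]
      push_cast
      rfl
    · intro x hx
      refine mul_pos (Real.exp_pos _) ?_
      have hk : 0 < σ * Real.exp (-μ) := mul_pos hσ (Real.exp_pos _)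
      have m1 : 0 ≤ ∫ s in x..1, w s := intervalIntegral.integral_nonneg hx.2
        fun s hs => (hw0 s ⟨hx.1.trans hs.1, hs.2⟩).le
      have m2 : 0 ≤ ∫ s in (0 : ℝ)..x, w s := intervalIntegral.integral_nonneg hx.1
        fun s hs => (hw0 s ⟨hs.1, hs.2.trans hx.2⟩).le
      rcases hx.2.lt_or_eq with hlt | heq
      · have : 0 < ∫ s in x..1, w s := intervalIntegral.intervalIntegral_pos_of_pos_on (hint _ _)
          (fun s hs => hw0 s ⟨hx.1.trans hs.1.le, hs.2.le⟩) hlt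
        positivity
      · have : 0 < ∫ s in (0 : ℝ)..x, w s :=
          intervalIntegral.intervalIntegral_pos_of_pos_on (hint _ _)
            (fun s hs => hw0 s ⟨hs.1.le, hs.2.le.trans hx.2⟩) (by linarith)
        positivity

/-- The turning property excludes the upper half-plane, real coefficients carry this to the lower
one, and positivity excludes $\lambda>0$. -/
theorem nonpos_of_signedPi_eq_zero {ν : ℝ} {l : List ℝ} {lam : ℂ} (h : signedPi ν l 0 lam = 0) :
    ∃ b : ℝ, 0 ≤ b ∧ lam = -b := by
  have h01 : (0 : ℝ) ∈ Icc (0 : ℝ) 1 := ⟨le_rfl, zero_le_one⟩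
  have him : lam.im = 0 := by
    rcases lt_trichotomy lam.im 0 with hneg | h0 | hpos
    · have hpos : 0 < (conj lam).im := by simpa using hneg
      refine absurd ?_ ((isTurning_signedPi ν l hpos).ne_zero 0 h01)
      simp only [(isPolynomialFamily_signedPi ν l).conj, h, map_zero]
    · exact h0
    · exact absurd h ((isTurning_signedPi ν l hpos).ne_zero 0 h01)
  have hre : lam = (lam.re : ℂ) := Complex.ext rfl him
  refine ⟨-lam.re, neg_nonneg.2 (le_of_not_gt fun hpos => ?_), by simpa using hre⟩
  obtain ⟨q, -, hqe, hq0⟩ := signedPi_ofReal_pos ν l hpos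
  rw [hre, hqe, Complex.ofReal_eq_zero] at h
  exact (hq0 0 h01).ne' h

/-! ### Circles as admissible contours -/

/-- The circle of radius `R` about the origin, traversed once counterclockwise. -/
noncomputable def circlePath (R : ℝ) : Path (R : ℂ) (R : ℂ) where
  toFun t := circleMap 0 R (2 * Real.pi * t)
  continuous_toFun := by fun_prop
  source' := by simp [circleMap]
  target' := by simp [circleMap]

theorem circlePath_extend (R : ℝ) :
    EqOn (circlePath R).extend (fun t => circleMap 0 R (2 * Real.pi * t)) (Icc 0 1) :=
  fun _ ht => (circlePath R).extend_apply ht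

theorem norm_of_mem_range_circlePath {R : ℝ} (hR : 0 ≤ R) {z : ℂ}
    (hz : z ∈ range (circlePath R)) : ‖z‖ = R := by
  obtain ⟨t, rfl⟩ := hz
  have : circlePath R t = circleMap 0 R (2 * Real.pi * t) := rfl
  rw [this, norm_circleMap_zero, abs_of_nonneg hR]

theorem isPiecewiseC1_circlePath (R : ℝ) : IsPiecewiseC1 (circlePath R) := by
  refine ⟨1, fun n => n, Nat.mono_cast, by simp, by simp, fun i hi => ?_⟩
  obtain rfl : i = 0 := by omega
  have h : ContDiff ℝ 1 fun t : ℝ => circleMap 0 R (2 * Real.pi * t) :=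
    (contDiff_circleMap 0 R).comp (contDiff_const.mul contDiff_id)
  refine h.contDiffOn.congr ?_
  exact fun t ht => circlePath_extend R (by simpa using ht)

theorem contourIntegral_circlePath (f : ℂ → ℂ) (R : ℝ) :
    contourIntegral f (circlePath R) = circleIntegral f 0 R := by
  have hs := intervalIntegral.smul_integral_comp_mul_left (a := 0) (b := 1)
    (fun θ => deriv (circleMap 0 R) θ • f (circleMap 0 R θ)) (2 * Real.pi)
  rw [mul_zero, mul_one] at hs
  rw [circleIntegral, ← hs, contourIntegral_eq_intervalIntegral,
    ← intervalIntegral.integral_smul]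
  refine intervalIntegral.integral_congr fun t ht => ?_
  rw [uIcc_of_le zero_le_one] at ht
  have hd : HasDerivAt (fun t : ℝ => circleMap 0 R (2 * Real.pi * t))
      ((2 * Real.pi) • deriv (circleMap 0 R) (2 * Real.pi * t)) t := by
    have h1 : HasDerivAt (fun t : ℝ => 2 * Real.pi * t) (2 * Real.pi) t := by
      simpa using (hasDerivAt_id t).const_mul (2 * Real.pi)
    exact (differentiable_circleMap 0 R _).hasDerivAt.scomp t h1
  have hd' : derivWithin (circlePath R).extend (Icc 0 1) t =
      (2 * Real.pi) • deriv (circleMap 0 R) (2 * Real.pi * t) := by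
    rw [derivWithin_congr (circlePath_extend R) (circlePath_extend R ht)]
    exact hd.hasDerivWithinAt.derivWithin (uniqueDiffOn_Icc zero_lt_one t ht)
  simp only [hd', circlePath_extend R ht, smul_eq_mul, Complex.real_smul]
  ring

theorem windingNumber_circlePath_of_lt {R : ℝ} {w : ℂ} (hw : ‖w‖ < R) :
    windingNumber (circlePath R) w = 1 := by
  rw [windingNumber, contourIntegral_circlePath,
    circleIntegral.integral_sub_inv_of_mem_ball (mem_ball_zero_iff.2 hw),
    inv_mul_cancel₀ Complex.two_pi_I_ne_zero]

theorem windingNumber_circlePath_of_gt {R : ℝ} (hR : 0 ≤ R) {w : ℂ} (hw : R < ‖w‖) :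
    windingNumber (circlePath R) w = 0 := by
  have hne : ∀ z : ℂ, ‖z‖ ≤ R → z - w ≠ 0 := fun z hz h =>
    (hw.trans_le (sub_eq_zero.1 h ▸ hz)).false
  rw [windingNumber, contourIntegral_circlePath,
    Complex.circleIntegral_eq_zero_of_differentiable_on_off_countable hR countable_empty ?_ ?_,
    mul_zero]
  · exact ContinuousOn.inv₀ (by fun_prop) fun z hz => hne z (mem_closedBall_zero_iff.1 hz)
  · intro z hz
    have := hne z (mem_ball_zero_iff.1 hz.1).le
    fun_prop (disch := assumption)

/-- If $e^w=\lambda$ then $|w|\ge\operatorname{Re}w=\log|\lambda|>R$, so every such $w$ is outside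
the circle. -/
theorem isAdmissible_circlePath {Λ : Multiset ℝ} {R : ℝ} (hR : 0 ≤ R) (hΛ : ∀ μ ∈ Λ, |μ| < R)
    {lam : ℂ} (hlam : Real.exp R < ‖lam‖) : IsAdmissible Λ lam (circlePath R) := by
  have h1 : ∀ μ ∈ Λ, ‖(μ : ℂ)‖ < R := fun μ hμ => by simpa using hΛ μ hμ
  have h2 : ∀ w : ℂ, Complex.exp w = lam → R < ‖w‖ := by
    rintro w rfl
    rw [Complex.norm_exp, Real.exp_lt_exp] at hlam
    exact hlam.trans_le (Complex.re_le_norm w)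
  exact
    { piecewiseC1 := isPiecewiseC1_circlePath R
      notMem_of_mem := fun μ hμ h => (h1 μ hμ).ne (norm_of_mem_range_circlePath hR h)
      winding_eq_one := fun μ hμ => windingNumber_circlePath_of_lt (h1 μ hμ)
      notMem_of_exp_eq := fun w hw h => (h2 w hw).ne' (norm_of_mem_range_circlePath hR h)
      winding_eq_zero := fun w hw => windingNumber_circlePath_of_gt hR (h2 w hw) }

/-! ### The Euler-Frobenius polynomial -/

theorem IsPi.unique {Λ : Multiset ℝ} {x : ℝ} {P Q : ℂ[X]} (hP : IsPi Λ x P) (hQ : IsPi Λ x Q) :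
    P = Q := by
  obtain ⟨R, hR0, hR⟩ : ∃ R : ℝ, 0 ≤ R ∧ ∀ μ ∈ Λ, |μ| < R := by
    obtain ⟨R, hR⟩ := (Λ.toFinset.image fun μ => |μ|).bddAbove
    refine ⟨max R 0 + 1, by positivity, fun μ hμ => ?_⟩
    have : |μ| ≤ R := hR (by simpa using ⟨μ, hμ, rfl⟩)
    have := le_max_left R 0
    linarith
  refine Polynomial.eq_of_infinite_eval_eq P Q
    (Infinite.mono ?_ ((Ioi_infinite (Real.exp R)).image Complex.ofReal_injective.injOn))
  rintro _ ⟨t, ht, rfl⟩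
  have hadm := isAdmissible_circlePath (lam := (t : ℂ)) hR0 hR
    (by rw [Complex.norm_real]; exact lt_of_lt_of_le ht (le_abs_self t))
  exact (hP _ _ _ hadm).trans (hQ _ _ _ hadm).symm

theorem exists_isEulerFrobenius (Λ : Multiset ℝ) :
    ∃ P : ℂ[X], IsEulerFrobenius Λ P ∧ ∀ z ∈ P.roots, ∃ b : ℝ, 0 ≤ b ∧ z = -b := by
  rcases Multiset.empty_or_exists_mem Λ with rfl | ⟨ν, hν⟩
  -- For the empty vector the polynomial is zero, whose `roots` is the empty multiset.
  · exact ⟨0, fun lam a Γ h => by simp [h.A_zero], by simp⟩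
  obtain ⟨Λ, rfl⟩ := Multiset.exists_cons_of_mem hν
  induction Λ using Quotient.inductionOn with
  | h l =>
  obtain ⟨P, hP⟩ := (isPolynomialFamily_signedPi ν l).exists_polynomial 0
  refine ⟨Polynomial.C ((-1) ^ l.length) * P, fun lam a Γ h => ?_, fun z hz => ?_⟩
  · rw [Polynomial.eval_mul, Polynomial.eval_C, hP]
    exact (h.r_mul_A_eq 0).symm
  · have := (Polynomial.mem_roots'.1 hz).2
    rw [Polynomial.IsRoot, Polynomial.eval_mul, Polynomial.eval_C, hP] at this
    exact nonpos_of_signedPi_eq_zero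
      ((mul_eq_zero.1 this).resolve_left (pow_ne_zero _ (by norm_num)))

/-! ### Comparing moduli through the distances to the roots -/

theorem norm_eval_eq_mul_prod (P : ℂ[X]) (z : ℂ) :
    ‖P.eval z‖ = ‖P.leadingCoeff‖ * (P.roots.map fun a => ‖z - a‖).prod := by
  rw [(IsAlgClosed.splits P).eval_eq_prod_roots, norm_mul]
  congr 1
  induction P.roots using Multiset.induction_on with
  | empty => simp
  | cons a s ih => simp [ih]

theorem norm_eval_le_norm_eval (P : ℂ[X]) {z w : ℂ} (h : ∀ a ∈ P.roots, ‖z - a‖ ≤ ‖w - a‖) :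
    ‖P.eval z‖ ≤ ‖P.eval w‖ := by
  rw [norm_eval_eq_mul_prod, norm_eval_eq_mul_prod]
  exact mul_le_mul_of_nonneg_left
    (Multiset.prod_map_le_prod_map₀ _ _ (fun _ _ => norm_nonneg _) h) (norm_nonneg _)

end ExpSpline

theorem mainTheorem7 (Λ : Multiset ℝ) (hΛ : Λ.map (fun μ => -μ) = Λ) :
    (∃! P : Polynomial ℂ, ExpSpline.IsEulerFrobenius Λ P) ∧
      ∀ P : Polynomial ℂ, ExpSpline.IsEulerFrobenius Λ P → ∀ ξ : ℝ,
        ‖P.eval (-1)‖ ≤ ‖P.eval (Complex.exp (Complex.I * (ξ : ℂ)))‖ ∧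
          ‖P.eval (Complex.exp (Complex.I * (ξ : ℂ)))‖ ≤ ‖P.eval 1‖ := by
  obtain ⟨Q, hQ, hroots⟩ := ExpSpline.exists_isEulerFrobenius Λ
  refine ⟨⟨Q, hQ, fun P hP => ExpSpline.IsPi.unique hP hQ⟩, fun P hP ξ => ?_⟩
  obtain rfl : P = Q := ExpSpline.IsPi.unique hP hQ
  have hz : ‖Complex.exp (Complex.I * (ξ : ℂ))‖ = 1 := Complex.norm_exp_I_mul_ofReal ξ
  generalize Complex.exp (Complex.I * (ξ : ℂ)) = z at hz ⊢
  refine ⟨ExpSpline.norm_eval_le_norm_eval P fun a ha => ?_,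
    ExpSpline.norm_eval_le_norm_eval P fun a ha => ?_⟩ <;>
  obtain ⟨b, hb, rfl⟩ := hroots a ha
  · have h1 : ‖(-1 : ℂ) - -b‖ = |b - 1| := by
      rw [← Real.norm_eq_abs, ← Complex.norm_real]
      congr 1
      push_cast
      ring
    -- The reverse triangle inequality, $|b-1|\le|b+z|$.
    have h2 := abs_norm_sub_norm_le (b : ℂ) (-z)
    rw [norm_neg, hz, Complex.norm_real, Real.norm_eq_abs, abs_of_nonneg hb] at h2
    rw [h1]
    refine h2.trans_eq ?_
    congr 1
    ring
  · have h1 : ‖(1 : ℂ) - -b‖ = 1 + b := by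
      rw [show (1 : ℂ) - -b = ((1 + b : ℝ) : ℂ) by push_cast; ring, Complex.norm_real,
        Real.norm_eq_abs, abs_of_nonneg (by positivity)]
    rw [h1]
    refine (norm_sub_le _ _).trans_eq ?_
    rw [norm_neg, hz, Complex.norm_real, Real.norm_eq_abs, abs_of_nonneg hb]
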